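/- Let $n\ge 1$ and let $g:\mathbb C\to\mathbb C$ be Borel measurable. For a complex-valued function $f$ on $\mathbb R^n$ put $T_g f:=g\circ f$. All cubes below are open with sides parallel to the coordinate axes; an $\varepsilon$-cube is a cube of side length $\varepsilon$, and $Q_0:=(0,1)^n$. For a cube $Q$ and a function $f$ integrable on $Q$ let $f_Q:=\frac1{|Q|}\int_Q f\,dx$ and $M(f,Q):=\frac1{|Q|}\int_Q|f(x)-f_Q|\,dx$. For $\varepsilon\in(0,1)$ and $\Omega\in\{\mathbb R^n,Q_0\}$ let $$[f]_{\varepsilon,\Omega}:=\sup_{\mathcal F_\varepsilon}\ \varepsilon^{n-1}\sum_{Q\in\mathcal F_\varepsilon}M(f,Q),$$ where the supremum is over all collections $\mathcal F_\varepsilon$ of mutually disjoint $\varepsilon$-cubes contained in $\Omega$ with $\#\mathcal F_\varepsilon\le \varepsilon^{1-n}$. Let $\mathrm B(\mathbb R^n)$ be the space of all $f\in L^1_{\rm loc}(\mathbb R^n)$ with $$\|f\|_{\mathrm B(\mathbb R^n)}:=\sup_{|Q|=1}\int_Q|f|\,dx+\sup_{0<\varepsilon<1}[f]_{\varepsilon,\mathbb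 R^n}<\infty ,$$ and let $\mathrm B(Q_0)$ be the space of all $f\in L^1(Q_0)$ with $$\|f\|_{\mathrm B(Q_0)}:=\int_{Q_0}|f|\,dx+\sup_{0<\varepsilon<1}[f]_{\varepsilon,Q_0}<\infty .$$ Let $\mathrm B_c(\mathbb R^n)$ be the closure of $C_c^\infty(\mathbb R^n)$ in $\mathrm B(\mathbb R^n)$, and $\mathrm B_c(Q_0)$ the closure of $C_c^\infty(Q_0)$ in $\mathrm B(Q_0)$. Then the following five statements are equivalent: (i) $\sup_{x,y\in\mathbb C}(1+|x-y|)^{-1}|g(x)-g(y)|<\infty$; (ii) $T_g(\mathrm B(\mathbb R^n))\subset \mathrm B(\mathbb R^n)$; (iii) $T_g(\mathrm B_c(\mathbb R^n))\subset \mathrm B(\mathbb R^n)$; (iv) $T_g(\mathrm B(Q_0))\subset \mathrm B(Q_0)$; (v) $T_g(\mathrm B_c(Q_0))\subset \mathrm B(Q_0)$. Moreover, if any of these holds, then $T_g$ maps bounded subsets of $\mathrm B(\mathbb R^n)$ to bounded subsets of $\mathrm B(\mathbb R^n)$, and bounded subsets of $\mathrm B(Q_0)$ to bounded subsets of $\mathrm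 B(Q_0)$. -/

import Mathlib

open MeasureTheory Set
open scoped ENNReal ContDiff

noncomputable section

namespace BSpaces

/-- The open axis-parallel cube in `ℝⁿ` with centre `a` and side length `r`.  Here `ℝⁿ` is
`Fin n → ℝ`; only its Lebesgue measure and its smooth structure are used, and these do not depend
on the choice of a norm. -/
def cube {n : ℕ} (a : Fin n → ℝ) (r : ℝ) : Set (Fin n → ℝ) :=
  Set.pi Set.univ fun i => Set.Ioo (a i - r / 2) (a i + r / 2)

/-- The open unit cube `Q₀ = (0,1)ⁿ`. -/
def unitCube (n : ℕ) : Set (Fin n → ℝ) :=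
  Set.pi Set.univ fun _ => Set.Ioo 0 1

/-- The mean oscillation `M(f,Q) = ⨍_Q |f - f_Q|`, as an extended nonnegative number. -/
def meanOsc {n : ℕ} (f : (Fin n → ℝ) → ℂ) (Q : Set (Fin n → ℝ)) : ℝ≥0∞ :=
  ⨍⁻ x in Q, ‖f x - ⨍ y in Q, f y ∂volume‖ₑ ∂volume

/-- `J` is the set of centres of a family of mutually disjoint `ε`-cubes contained in `Ω`, of
cardinality at most `1 / ε ^ (n - 1)`. -/
def IsCubeFamily {n : ℕ} (Ω : Set (Fin n → ℝ)) (ε : ℝ) (J : Finset (Fin n → ℝ)) : Prop :=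
  (∀ a ∈ J, cube a ε ⊆ Ω) ∧
  (J : Set (Fin n → ℝ)).PairwiseDisjoint (fun a => cube a ε) ∧
  (J.card : ℝ) ≤ 1 / ε ^ (n - 1)

/-- `[f]_{ε,Ω}`: the supremum of `ε ^ (n - 1) * ∑ M(f,Q)` over all admissible families of
`ε`-cubes contained in `Ω` (`Ω = ℝⁿ` gives `[f]_ε`, `Ω = Q₀` gives `[f]_{ε,Q₀}`). -/
def oscSum {n : ℕ} (Ω : Set (Fin n → ℝ)) (ε : ℝ) (f : (Fin n → ℝ) → ℂ) : ℝ≥0∞ :=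
  ⨆ (J : Finset (Fin n → ℝ)) (_ : IsCubeFamily Ω ε J),
    ENNReal.ofReal (ε ^ (n - 1)) * ∑ a ∈ J, meanOsc f (cube a ε)

/-- `‖f‖_{B(ℝⁿ)}`, with value `∞` allowed. -/
def normB {n : ℕ} (f : (Fin n → ℝ) → ℂ) : ℝ≥0∞ :=
  (⨆ a : Fin n → ℝ, ∫⁻ x in cube a 1, ‖f x‖ₑ ∂volume) +
    ⨆ ε ∈ Set.Ioo (0 : ℝ) 1, oscSum Set.univ ε f

/-- `‖f‖_{B(Q₀)}`, with value `∞` allowed. -/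
def normBUnit {n : ℕ} (f : (Fin n → ℝ) → ℂ) : ℝ≥0∞ :=
  (∫⁻ x in unitCube n, ‖f x‖ₑ ∂volume) +
    ⨆ ε ∈ Set.Ioo (0 : ℝ) 1, oscSum (unitCube n) ε f

/-- The space `B(ℝⁿ)`.  Its elements are represented by functions; membership and norm are
invariant under changes on null sets. -/
def B (n : ℕ) : Set ((Fin n → ℝ) → ℂ) :=
  {f | LocallyIntegrable f volume ∧ normB f < ⊤}

/-- The space `B(Q₀)`.  Its elements are represented by functions on `ℝⁿ`, of which only the
values on `Q₀` matter. -/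
def BUnit (n : ℕ) : Set ((Fin n → ℝ) → ℂ) :=
  {f | IntegrableOn f (unitCube n) volume ∧ normBUnit f < ⊤}

/-- `C_c^∞(Ω)`: smooth complex functions whose support is a compact subset of `Ω`. -/
def testFunctions {n : ℕ} (Ω : Set (Fin n → ℝ)) : Set ((Fin n → ℝ) → ℂ) :=
  {φ | ContDiff ℝ ∞ φ ∧ HasCompactSupport φ ∧ tsupport φ ⊆ Ω}

/-- `B_c(ℝⁿ)`: the closure of `C_c^∞(ℝⁿ)` in `B(ℝⁿ)`. -/
def Bc (n : ℕ) : Set ((Fin n → ℝ) → ℂ) :=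
  {f | f ∈ B n ∧ ∀ δ : ℝ≥0∞, 0 < δ → ∃ φ ∈ testFunctions (Set.univ : Set (Fin n → ℝ)),
    normB (f - φ) < δ}

/-- `B_c(Q₀)`: the closure of `C_c^∞(Q₀)` in `B(Q₀)`. -/
def BcUnit (n : ℕ) : Set ((Fin n → ℝ) → ℂ) :=
  {f | f ∈ BUnit n ∧ ∀ δ : ℝ≥0∞, 0 < δ → ∃ φ ∈ testFunctions (unitCube n),
    normBUnit (f - φ) < δ}

/-- The superposition operator `T_g f = g ∘ f`. -/
def superposition {n : ℕ} (g : ℂ → ℂ) (f : (Fin n → ℝ) → ℂ) : (Fin n → ℝ) → ℂ :=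
  fun x => g (f x)

/-- Bounded subsets of `B(ℝⁿ)`. -/
def IsBoundedInB {n : ℕ} (S : Set ((Fin n → ℝ) → ℂ)) : Prop :=
  S ⊆ B n ∧ ∃ R : ℝ≥0∞, R < ⊤ ∧ ∀ f ∈ S, normB f ≤ R

/-- Bounded subsets of `B(Q₀)`. -/
def IsBoundedInBUnit {n : ℕ} (S : Set ((Fin n → ℝ) → ℂ)) : Prop :=
  S ⊆ BUnit n ∧ ∃ R : ℝ≥0∞, R < ⊤ ∧ ∀ f ∈ S, normBUnit f ≤ R

/-- `sup_{x,y ∈ ℂ} (1 + |x - y|)⁻¹ |g(x) - g(y)| < ∞`. -/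
def HasLinearIncrements (g : ℂ → ℂ) : Prop :=
  BddAbove (Set.range fun p : ℂ × ℂ => (1 + ‖p.1 - p.2‖)⁻¹ * ‖g p.1 - g p.2‖)

end BSpaces

end

/-!
Two features of the seminorm drive the proof. An admissible family of `ε`-cubes has at most
`ε ^ (1 - n)` members, so a bound for the mean oscillation on all cubes bounds `[f]_ε`: functions
of small BMO norm have small norm. On the other hand `[f]_ε` is large as soon as `f` oscillates on
a fixed proportion of the cubes of side `ε` along a hyperplane.

If `g` has linear increments with constant `C`, comparing `g ∘ f` with the constant `g (f_Q)` gives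
`M(g ∘ f, Q) ≤ 2 * C * (1 + M(f, Q))` (`meanOsc_superposition_le`). Summing over a family yields
norm bounds that are affine in the norm of `f`, hence all the positive statements.

If `g` does not have linear increments, subdividing segments produces pairs `x, y` that are as
close as desired while `|g x - g y|` is as large as desired (`exists_large_jump`); there is no
control on `|x|`. A test function that equals `x` in a thin slab around a hyperplane except very
near the hyperplane, where it equals `y`, has an image under `T_g` with oscillation comparable to
`|g x - g y|` (`le_oscSum_of_jump`). Its norm can nevertheless be made small: to reach
the height `x`, the function rises logarithmically, by an average of `m` dyadically shrinking bumps,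
whose mean oscillation is `O(1 / m)` because each scale sees boundedly many of them
(`exists_hasOscBound_logBump`), and the jump from `x` to `y` costs `O(|x - y|)`. Such blocks
(`exists_block`), placed in disjoint slabs with summable norms and unbounded jumps of `g`, add up to
a limit of test functions whose image under `T_g` has infinite norm.
-/

namespace BSpaces

/-! ### Cubes -/

section Cubes

variable {n : ℕ}

lemma measurableSet_cube (a : Fin n → ℝ) (r : ℝ) : MeasurableSet (cube a r) :=
  MeasurableSet.univ_pi fun _ => measurableSet_Ioo

lemma volume_cube (a : Fin n → ℝ) (r : ℝ) : volume (cube a r) = ENNReal.ofReal r ^ n := by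
  rw [cube, Real.volume_pi_Ioo]
  simp

lemma volume_cube_ne_top (a : Fin n → ℝ) (r : ℝ) : volume (cube a r) ≠ ⊤ := by
  simp [volume_cube]

lemma volume_cube_ne_zero (a : Fin n → ℝ) {r : ℝ} (hr : 0 < r) : volume (cube a r) ≠ 0 := by
  rw [volume_cube]
  exact pow_ne_zero _ (by simpa using hr)

lemma unitCube_eq_cube : unitCube n = cube (fun _ => 1 / 2) 1 := by
  simp only [unitCube, cube]
  norm_num

/-- The normalized Lebesgue measure on a set `Q`: averages over `Q` are integrals against it. -/
noncomputable abbrev avgMeasure (Q : Set (Fin n → ℝ)) : Measure (Fin n → ℝ) :=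
  (volume Q)⁻¹ • volume.restrict Q

lemma meanOsc_eq (f : (Fin n → ℝ) → ℂ) (Q : Set (Fin n → ℝ)) :
    meanOsc f Q = ∫⁻ x, ‖f x - ∫ y, f y ∂avgMeasure Q‖ₑ ∂avgMeasure Q := by
  simp only [meanOsc, average, laverage, avgMeasure, Measure.restrict_apply_univ]

lemma isProbabilityMeasure_avgMeasure (a : Fin n → ℝ) {r : ℝ} (hr : 0 < r) :
    IsProbabilityMeasure (avgMeasure (cube a r)) := by
  refine ⟨?_⟩
  rw [Measure.smul_apply, Measure.restrict_apply_univ, smul_eq_mul]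
  exact ENNReal.inv_mul_cancel (volume_cube_ne_zero a hr) (volume_cube_ne_top a r)

lemma integrable_avgMeasure {f : (Fin n → ℝ) → ℂ} {a : Fin n → ℝ} {r : ℝ} (hr : 0 < r)
    (hf : IntegrableOn f (cube a r)) : Integrable f (avgMeasure (cube a r)) :=
  Integrable.smul_measure hf (ENNReal.inv_ne_top.2 (volume_cube_ne_zero a hr))

end Cubes

/-! ### Mean oscillation -/

section MeanOsc

variable {n : ℕ}

lemma enorm_integral_sub_le {α : Type*} [MeasurableSpace α] {ν : Measure α}
    [IsProbabilityMeasure ν] {f : α → ℂ} (hf : Integrable f ν) (c : ℂ) :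
    ‖c - ∫ y, f y ∂ν‖ₑ ≤ ∫⁻ x, ‖f x - c‖ₑ ∂ν := by
  have h : (∫ y, (c - f y) ∂ν) = c - ∫ y, f y ∂ν := by
    rw [integral_sub (integrable_const c) hf]
    simp
  rw [← h]
  refine (enorm_integral_le_lintegral_enorm _).trans_eq ?_
  simp_rw [enorm_sub_rev]

/-- Up to a factor `2`, the mean is the best constant approximation. -/
lemma meanOsc_le_two_mul {f : (Fin n → ℝ) → ℂ} {a : Fin n → ℝ} {r : ℝ} (hr : 0 < r)
    (hf : IntegrableOn f (cube a r)) (c : ℂ) :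
    meanOsc f (cube a r) ≤ 2 * ∫⁻ x, ‖f x - c‖ₑ ∂avgMeasure (cube a r) := by
  have := isProbabilityMeasure_avgMeasure a hr
  have hf' := integrable_avgMeasure hr hf
  rw [meanOsc_eq]
  set ν := avgMeasure (cube a r)
  calc ∫⁻ x, ‖f x - ∫ y, f y ∂ν‖ₑ ∂ν
      ≤ ∫⁻ x, (‖f x - c‖ₑ + ‖c - ∫ y, f y ∂ν‖ₑ) ∂ν := by
        refine lintegral_mono fun x => ?_
        rw [← sub_add_sub_cancel (f x) c]
        exact enorm_add_le _ _
    _ = (∫⁻ x, ‖f x - c‖ₑ ∂ν) + ‖c - ∫ y, f y ∂ν‖ₑ := by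
        rw [lintegral_add_right _ measurable_const]
        simp
    _ ≤ 2 * ∫⁻ x, ‖f x - c‖ₑ ∂ν := by
        rw [two_mul]
        gcongr
        exact enorm_integral_sub_le hf' c

/-- A function taking the value `u` on `E₁` and `v` on `E₂`, both filling a fixed proportion of
`Q`, oscillates by at least that proportion of `|u - v|`.  The bound holds for any choice of the
constant `f_Q`, so no integrability is needed. -/
lemma mul_enorm_sub_le_meanOsc {f : (Fin n → ℝ) → ℂ} {Q E₁ E₂ : Set (Fin n → ℝ)}
    (h₁ : MeasurableSet E₁) (h₂ : MeasurableSet E₂) (hd : Disjoint E₁ E₂) (hE₁ : E₁ ⊆ Q)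
    (hE₂ : E₂ ⊆ Q) {u v : ℂ} (hu : ∀ x ∈ E₁, f x = u) (hv : ∀ x ∈ E₂, f x = v) {p : ℝ≥0∞}
    (hp₁ : p ≤ volume E₁ / volume Q) (hp₂ : p ≤ volume E₂ / volume Q) :
    p * ‖u - v‖ₑ ≤ meanOsc f Q := by
  rw [meanOsc_eq]
  set c := ∫ y, f y ∂avgMeasure Q
  have key : ∀ {E : Set (Fin n → ℝ)} {w : ℂ}, MeasurableSet E → E ⊆ Q → (∀ x ∈ E, f x = w) →
      p ≤ volume E / volume Q → p * ‖w - c‖ₑ ≤ ∫⁻ x in E, ‖f x - c‖ₑ ∂avgMeasure Q := by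
    intro E w hE hEQ hw hp
    rw [setLIntegral_congr_fun (g := fun _ => ‖w - c‖ₑ) hE (fun x hx => by simp [hw x hx]),
      setLIntegral_const, mul_comm]
    gcongr
    rw [Measure.smul_apply, Measure.restrict_apply hE, inter_eq_self_of_subset_left hEQ,
      smul_eq_mul, mul_comm, ← div_eq_mul_inv]
    exact hp
  calc p * ‖u - v‖ₑ ≤ p * (‖u - c‖ₑ + ‖v - c‖ₑ) := by
        gcongr
        rw [← sub_sub_sub_cancel_right u v c]
        exact enorm_sub_le
    _ ≤ (∫⁻ x in E₁, ‖f x - c‖ₑ ∂avgMeasure Q) + ∫⁻ x in E₂, ‖f x - c‖ₑ ∂avgMeasure Q := by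
        rw [mul_add]
        exact add_le_add (key h₁ hE₁ hu hp₁) (key h₂ hE₂ hv hp₂)
    _ = ∫⁻ x in E₁ ∪ E₂, ‖f x - c‖ₑ ∂avgMeasure Q := (lintegral_union h₂ hd).symm
    _ ≤ _ := setLIntegral_le_lintegral _ _

lemma meanOsc_const_mul (c : ℂ) (f : (Fin n → ℝ) → ℂ) (Q : Set (Fin n → ℝ)) :
    meanOsc (fun x => c * f x) Q = ‖c‖ₑ * meanOsc f Q := by
  rw [meanOsc_eq, meanOsc_eq, integral_const_mul, ← lintegral_const_mul' _ _ enorm_ne_top]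
  simp_rw [← mul_sub, enorm_mul]

/-- Countable subadditivity of the mean oscillation. -/
lemma meanOsc_tsum_le {ι : Type*} [Countable ι] {u : ι → (Fin n → ℝ) → ℂ}
    (hm : ∀ k, Measurable (u k)) (hs : ∑' k, ∫⁻ x, ‖u k x‖ₑ ≠ ⊤) (hp : ∀ x, Summable fun k => u k x)
    {a : Fin n → ℝ} {r : ℝ} (hr : 0 < r) :
    meanOsc (fun x => ∑' k, u k x) (cube a r) ≤ ∑' k, meanOsc (u k) (cube a r) := by
  simp_rw [meanOsc_eq]
  set ν := avgMeasure (cube a r)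
  have hν : ∀ k, ∫⁻ x, ‖u k x‖ₑ ∂ν ≤ (volume (cube a r))⁻¹ * ∫⁻ x, ‖u k x‖ₑ := fun k => by
    rw [lintegral_smul_measure, smul_eq_mul]
    gcongr
    exact Measure.restrict_le_self
  have hsν : ∑' k, ∫⁻ x, ‖u k x‖ₑ ∂ν ≠ ⊤ := by
    refine ne_top_of_le_ne_top ?_ (ENNReal.tsum_le_tsum hν)
    rw [ENNReal.tsum_mul_left]
    exact ENNReal.mul_ne_top (ENNReal.inv_ne_top.2 (volume_cube_ne_zero a hr)) hs
  have hint : Summable fun k => ∫ x, u k x ∂ν := by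
    refine Summable.of_enorm (ne_top_of_le_ne_top hsν ?_)
    exact ENNReal.tsum_le_tsum fun k => enorm_integral_le_lintegral_enorm _
  rw [integral_tsum (fun k => (hm k).aestronglyMeasurable) hsν,
    ← lintegral_tsum fun k => ((hm k).sub_const _).enorm.aemeasurable]
  refine lintegral_mono fun x => ?_
  simp only []
  rw [← (hp x).tsum_sub hint]
  exact enorm_tsum_le_tsum_enorm

end MeanOsc

/-! ### Functions with small norm -/

section OscBound

variable {n : ℕ}

/-- `HasOscBound f η`: the measurable function `f` has `L¹` norm at most `η`, and mean oscillation
at most `η` on every cube.  Since an admissible family of `ε`-cubes has at most `ε ^ (1 - n)`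
members, this makes the norm of `f` in `B(ℝⁿ)` at most `2 * η`. -/
def HasOscBound (f : (Fin n → ℝ) → ℂ) (η : ℝ≥0∞) : Prop :=
  Measurable f ∧ ∫⁻ x, ‖f x‖ₑ ≤ η ∧ ∀ (a : Fin n → ℝ) (r : ℝ), 0 < r → meanOsc f (cube a r) ≤ η

lemma HasOscBound.mono {f : (Fin n → ℝ) → ℂ} {η η' : ℝ≥0∞} (h : HasOscBound f η) (hη : η ≤ η') :
    HasOscBound f η' :=
  ⟨h.1, h.2.1.trans hη, fun a r hr => (h.2.2 a r hr).trans hη⟩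

lemma HasOscBound.integrable {f : (Fin n → ℝ) → ℂ} {η : ℝ≥0∞} (h : HasOscBound f η) (hη : η ≠ ⊤) :
    Integrable f :=
  ⟨h.1.aestronglyMeasurable, lt_of_le_of_lt h.2.1 hη.lt_top⟩

lemma HasOscBound.const_mul {f : (Fin n → ℝ) → ℂ} {η : ℝ≥0∞} (h : HasOscBound f η) (c : ℂ) :
    HasOscBound (fun x => c * f x) (‖c‖ₑ * η) := by
  refine ⟨h.1.const_mul c, ?_, fun a r hr => ?_⟩
  · simp_rw [enorm_mul]
    rw [lintegral_const_mul' _ _ enorm_ne_top]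
    gcongr
    exact h.2.1
  · rw [meanOsc_const_mul]
    gcongr
    exact h.2.2 a r hr

lemma HasOscBound.tsum {ι : Type*} [Countable ι] {u : ι → (Fin n → ℝ) → ℂ} {η : ι → ℝ≥0∞}
    (h : ∀ k, HasOscBound (u k) (η k)) (hη : ∑' k, η k ≠ ⊤) (hp : ∀ x, Summable fun k => u k x) :
    HasOscBound (fun x => ∑' k, u k x) (∑' k, η k) := by
  have hs : ∑' k, ∫⁻ x, ‖u k x‖ₑ ≤ ∑' k, η k := ENNReal.tsum_le_tsum fun k => (h k).2.1
  refine ⟨Measurable.tsum fun k => (h k).1, ?_, fun a r hr => ?_⟩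
  · refine le_trans ?_ hs
    rw [← lintegral_tsum fun k => (h k).1.enorm.aemeasurable]
    exact lintegral_mono fun x => enorm_tsum_le_tsum_enorm
  · exact (meanOsc_tsum_le (fun k => (h k).1) (ne_top_of_le_ne_top hη hs) hp hr).trans
      (ENNReal.tsum_le_tsum fun k => (h k).2.2 a r hr)

lemma HasOscBound.add {f g : (Fin n → ℝ) → ℂ} {η η' : ℝ≥0∞} (hf : HasOscBound f η)
    (hg : HasOscBound g η') (hη : η ≠ ⊤) (hη' : η' ≠ ⊤) :
    HasOscBound (fun x => f x + g x) (η + η') := by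
  have := HasOscBound.tsum (u := fun b : Bool => bif b then f else g)
    (η := fun b : Bool => bif b then η else η') (by rintro (_ | _) <;> simpa)
    (by simp [hη, hη']) (fun x => (hasSum_fintype _).summable)
  simpa using this

lemma IsCubeFamily.mul_card_le {Ω : Set (Fin n → ℝ)} {ε : ℝ} (hε : 0 < ε)
    {J : Finset (Fin n → ℝ)} (hJ : IsCubeFamily Ω ε J) :
    ENNReal.ofReal (ε ^ (n - 1)) * (J.card : ℝ≥0∞) ≤ 1 := by
  rw [← ENNReal.ofReal_natCast, ← ENNReal.ofReal_mul (by positivity), ← ENNReal.ofReal_one]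
  refine ENNReal.ofReal_le_ofReal ?_
  have h2 := hJ.2.2
  rwa [le_div_iff₀ (by positivity), mul_comm] at h2

lemma le_oscSum {Ω : Set (Fin n → ℝ)} {ε : ℝ} {J : Finset (Fin n → ℝ)} (hJ : IsCubeFamily Ω ε J)
    (f : (Fin n → ℝ) → ℂ) :
    ENNReal.ofReal (ε ^ (n - 1)) * ∑ a ∈ J, meanOsc f (cube a ε) ≤ oscSum Ω ε f :=
  le_iSup₂ (f := fun (J : Finset (Fin n → ℝ)) (_ : IsCubeFamily Ω ε J) =>
    ENNReal.ofReal (ε ^ (n - 1)) * ∑ a ∈ J, meanOsc f (cube a ε)) J hJ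

/-- The cardinality bound on families turns a bound on each `M(f,Q)` into a bound on `[f]_ε`. -/
lemma oscSum_le {Ω : Set (Fin n → ℝ)} {ε : ℝ} (hε : 0 < ε) {f : (Fin n → ℝ) → ℂ} {η : ℝ≥0∞}
    (h : ∀ a, cube a ε ⊆ Ω → meanOsc f (cube a ε) ≤ η) : oscSum Ω ε f ≤ η := by
  refine iSup₂_le fun J hJ => ?_
  have h1 := hJ.mul_card_le hε
  calc ENNReal.ofReal (ε ^ (n - 1)) * ∑ a ∈ J, meanOsc f (cube a ε)
      ≤ ENNReal.ofReal (ε ^ (n - 1)) * ∑ a ∈ J, η := by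
        gcongr with a ha
        exact h a (hJ.1 a ha)
    _ = (ENNReal.ofReal (ε ^ (n - 1)) * (J.card : ℝ≥0∞)) * η := by
        rw [Finset.sum_const, nsmul_eq_mul, mul_assoc]
    _ ≤ 1 * η := by gcongr
    _ = η := one_mul η

lemma HasOscBound.normB_le {f : (Fin n → ℝ) → ℂ} {η : ℝ≥0∞} (h : HasOscBound f η) :
    normB f ≤ 2 * η := by
  rw [normB, two_mul]
  gcongr
  · exact iSup_le fun a => (setLIntegral_le_lintegral _ _).trans h.2.1
  · exact iSup₂_le fun ε hε => oscSum_le hε.1 fun a _ => h.2.2 a ε hε.1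

lemma oscSum_mono {Ω Ω' : Set (Fin n → ℝ)} (hΩ : Ω ⊆ Ω') (ε : ℝ) (f : (Fin n → ℝ) → ℂ) :
    oscSum Ω ε f ≤ oscSum Ω' ε f :=
  iSup₂_le fun _ hJ => le_oscSum ⟨fun a ha => (hJ.1 a ha).trans hΩ, hJ.2⟩ f

lemma normBUnit_le_normB (f : (Fin n → ℝ) → ℂ) : normBUnit f ≤ normB f := by
  rw [normBUnit, normB]
  gcongr with ε hε
  · rw [unitCube_eq_cube]
    exact le_iSup (fun a : Fin n → ℝ => ∫⁻ x in cube a 1, ‖f x‖ₑ) _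
  · exact oscSum_mono (subset_univ _) ε f

end OscBound

/-! ### Linear increments are sufficient -/

section Sufficiency

variable {n : ℕ}

lemma HasLinearIncrements.exists_bound {g : ℂ → ℂ} (h : HasLinearIncrements g) :
    ∃ C : ℝ, 0 ≤ C ∧ ∀ x y, ‖g x - g y‖ ≤ C * (1 + ‖x - y‖) := by
  obtain ⟨C, hC⟩ := h
  have hb : ∀ x y, ‖g x - g y‖ ≤ C * (1 + ‖x - y‖) := fun x y => by
    have h1 : (1 + ‖x - y‖)⁻¹ * ‖g x - g y‖ ≤ C := hC ⟨(x, y), rfl⟩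
    rwa [inv_mul_le_iff₀ (by positivity), mul_comm] at h1
  exact ⟨C, by simpa using hb 0 0, hb⟩

lemma enorm_sub_le_of_norm_sub_le {g : ℂ → ℂ} {C : ℝ} (hC : 0 ≤ C)
    (h : ∀ x y, ‖g x - g y‖ ≤ C * (1 + ‖x - y‖)) (x y : ℂ) :
    ‖g x - g y‖ₑ ≤ ENNReal.ofReal C * (1 + ‖x - y‖ₑ) := by
  rw [← ofReal_norm, ← ofReal_norm, ← ENNReal.ofReal_one, ← ENNReal.ofReal_add (by simp)
    (by positivity), ← ENNReal.ofReal_mul hC]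
  exact ENNReal.ofReal_le_ofReal (h x y)

lemma enorm_le_of_norm_sub_le {g : ℂ → ℂ} {C : ℝ} (hC : 0 ≤ C)
    (h : ∀ x y, ‖g x - g y‖ ≤ C * (1 + ‖x - y‖)) (x : ℂ) :
    ‖g x‖ₑ ≤ (‖g 0‖ₑ + ENNReal.ofReal C) + ENNReal.ofReal C * ‖x‖ₑ := by
  have h1 := enorm_sub_le_of_norm_sub_le hC h x 0
  rw [sub_zero, mul_add, mul_one] at h1
  calc ‖g x‖ₑ = ‖g 0 + (g x - g 0)‖ₑ := by simp
    _ ≤ ‖g 0‖ₑ + ‖g x - g 0‖ₑ := enorm_add_le _ _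
    _ ≤ _ := by rw [add_assoc]; gcongr

variable {g : ℂ → ℂ} {C : ℝ} {f : (Fin n → ℝ) → ℂ}

lemma setLIntegral_superposition_le (hC : 0 ≤ C) (h : ∀ x y, ‖g x - g y‖ ≤ C * (1 + ‖x - y‖))
    (Q : Set (Fin n → ℝ)) :
    ∫⁻ x in Q, ‖superposition g f x‖ₑ ≤
      (‖g 0‖ₑ + ENNReal.ofReal C) * volume Q + ENNReal.ofReal C * ∫⁻ x in Q, ‖f x‖ₑ := by
  refine (lintegral_mono fun x => enorm_le_of_norm_sub_le hC h (f x)).trans_eq ?_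
  rw [lintegral_add_left measurable_const, setLIntegral_const,
    lintegral_const_mul' _ _ ENNReal.ofReal_ne_top]

lemma integrableOn_superposition (hg : Measurable g) (hC : 0 ≤ C)
    (h : ∀ x y, ‖g x - g y‖ ≤ C * (1 + ‖x - y‖)) {Q : Set (Fin n → ℝ)} (hQ : volume Q ≠ ⊤)
    (hf : IntegrableOn f Q) : IntegrableOn (superposition g f) Q := by
  refine ⟨(hg.comp_aemeasurable hf.1.aemeasurable).aestronglyMeasurable, ?_⟩
  refine lt_of_le_of_lt (setLIntegral_superposition_le hC h Q) ?_
  have h1 : ∫⁻ x in Q, ‖f x‖ₑ < ⊤ := hf.2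
  finiteness

lemma meanOsc_superposition_le (hg : Measurable g) (hC : 0 ≤ C)
    (h : ∀ x y, ‖g x - g y‖ ≤ C * (1 + ‖x - y‖)) {a : Fin n → ℝ} {r : ℝ} (hr : 0 < r)
    (hf : IntegrableOn f (cube a r)) :
    meanOsc (superposition g f) (cube a r) ≤
      2 * ENNReal.ofReal C + 2 * ENNReal.ofReal C * meanOsc f (cube a r) := by
  have := isProbabilityMeasure_avgMeasure a hr
  refine (meanOsc_le_two_mul hr (integrableOn_superposition hg hC h (volume_cube_ne_top a r) hf)
    (g (∫ y, f y ∂avgMeasure (cube a r)))).trans ?_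
  rw [meanOsc_eq f, mul_assoc, ← mul_add]
  gcongr
  refine (lintegral_mono fun x => enorm_sub_le_of_norm_sub_le hC h _ _).trans_eq ?_
  rw [lintegral_const_mul' _ _ ENNReal.ofReal_ne_top, lintegral_add_left measurable_const, mul_add]
  simp

lemma oscSum_superposition_le (hg : Measurable g) (hC : 0 ≤ C)
    (h : ∀ x y, ‖g x - g y‖ ≤ C * (1 + ‖x - y‖)) {Ω : Set (Fin n → ℝ)} {ε : ℝ} (hε : 0 < ε)
    (hf : ∀ a, cube a ε ⊆ Ω → IntegrableOn f (cube a ε)) :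
    oscSum Ω ε (superposition g f) ≤
      2 * ENNReal.ofReal C + 2 * ENNReal.ofReal C * oscSum Ω ε f := by
  refine iSup₂_le fun J hJ => ?_
  have h1 := hJ.mul_card_le hε
  have h3 := le_oscSum hJ f
  calc ENNReal.ofReal (ε ^ (n - 1)) * ∑ a ∈ J, meanOsc (superposition g f) (cube a ε)
      ≤ ENNReal.ofReal (ε ^ (n - 1)) *
          ∑ a ∈ J, (2 * ENNReal.ofReal C + 2 * ENNReal.ofReal C * meanOsc f (cube a ε)) := by
        gcongr with a ha
        exact meanOsc_superposition_le hg hC h hε (hf a (hJ.1 a ha))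
    _ = (ENNReal.ofReal (ε ^ (n - 1)) * (J.card : ℝ≥0∞)) * (2 * ENNReal.ofReal C) +
          2 * ENNReal.ofReal C *
            (ENNReal.ofReal (ε ^ (n - 1)) * ∑ a ∈ J, meanOsc f (cube a ε)) := by
        rw [Finset.sum_add_distrib, Finset.sum_const, nsmul_eq_mul, ← Finset.mul_sum]
        ring
    _ ≤ 1 * (2 * ENNReal.ofReal C) + 2 * ENNReal.ofReal C * oscSum Ω ε f := by gcongr
    _ = _ := by rw [one_mul]

lemma normB_superposition_le (hg : Measurable g) (hC : 0 ≤ C)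
    (h : ∀ x y, ‖g x - g y‖ ≤ C * (1 + ‖x - y‖)) (hf : LocallyIntegrable f) :
    normB (superposition g f) ≤
      ‖g 0‖ₑ + 3 * ENNReal.ofReal C + 3 * ENNReal.ofReal C * normB f := by
  have h1 : (⨆ a : Fin n → ℝ, ∫⁻ x in cube a 1, ‖superposition g f x‖ₑ) ≤
      ‖g 0‖ₑ + ENNReal.ofReal C + ENNReal.ofReal C * normB f := by
    refine iSup_le fun a => (setLIntegral_superposition_le hC h _).trans ?_
    rw [volume_cube, ENNReal.ofReal_one, one_pow, mul_one]
    gcongr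
    exact (le_iSup (fun a : Fin n → ℝ => ∫⁻ x in cube a 1, ‖f x‖ₑ) a).trans le_self_add
  have h2 : (⨆ ε ∈ Ioo (0 : ℝ) 1, oscSum univ ε (superposition g f)) ≤
      2 * ENNReal.ofReal C + 2 * ENNReal.ofReal C * normB f := by
    refine iSup₂_le fun ε hε => (oscSum_superposition_le hg hC h hε.1 fun a _ => ?_).trans ?_
    · refine (hf.integrableOn_isCompact (k := Metric.closedBall a ε)
        (isCompact_closedBall _ _)).mono_set ?_
      intro x hx
      rw [Metric.mem_closedBall, dist_pi_le_iff hε.1.le]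
      intro i
      have := hx i (mem_univ i)
      rw [Real.dist_eq, abs_le]
      constructor <;> linarith [this.1, this.2, hε.1]
    · gcongr
      exact (le_iSup₂ (f := fun ε (_ : ε ∈ Ioo (0 : ℝ) 1) => oscSum univ ε f) ε hε).trans
        le_add_self
  calc normB (superposition g f) ≤ _ := add_le_add h1 h2
    _ = _ := by ring

lemma normBUnit_superposition_le (hg : Measurable g) (hC : 0 ≤ C)
    (h : ∀ x y, ‖g x - g y‖ ≤ C * (1 + ‖x - y‖)) (hf : IntegrableOn f (unitCube n)) :
    normBUnit (superposition g f) ≤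
      ‖g 0‖ₑ + 3 * ENNReal.ofReal C + 3 * ENNReal.ofReal C * normBUnit f := by
  have h1 : (∫⁻ x in unitCube n, ‖superposition g f x‖ₑ) ≤
      ‖g 0‖ₑ + ENNReal.ofReal C + ENNReal.ofReal C * normBUnit f := by
    refine (setLIntegral_superposition_le hC h _).trans ?_
    rw [unitCube_eq_cube, volume_cube, ENNReal.ofReal_one, one_pow, mul_one, ← unitCube_eq_cube]
    gcongr
    exact le_self_add
  have h2 : (⨆ ε ∈ Ioo (0 : ℝ) 1, oscSum (unitCube n) ε (superposition g f)) ≤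
      2 * ENNReal.ofReal C + 2 * ENNReal.ofReal C * normBUnit f := by
    refine iSup₂_le fun ε hε => (oscSum_superposition_le hg hC h hε.1 fun a ha =>
      hf.mono_set ha).trans ?_
    gcongr
    exact (le_iSup₂ (f := fun ε (_ : ε ∈ Ioo (0 : ℝ) 1) => oscSum (unitCube n) ε f) ε hε).trans
      le_add_self
  calc normBUnit (superposition g f) ≤ _ := add_le_add h1 h2
    _ = _ := by ring

/-- Under linear increments, `T_g` maps `B(ℝⁿ)` and its bounded subsets to such. -/
lemma HasLinearIncrements.isBoundedInB_image (hl : HasLinearIncrements g) (hg : Measurable g)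
    {S : Set ((Fin n → ℝ) → ℂ)} (hS : IsBoundedInB S) : IsBoundedInB (superposition g '' S) := by
  obtain ⟨C, hC, h⟩ := hl.exists_bound
  obtain ⟨hSB, R, hR, hSR⟩ := hS
  have hb : ∀ f ∈ S, normB (superposition g f) ≤
      ‖g 0‖ₑ + 3 * ENNReal.ofReal C + 3 * ENNReal.ofReal C * R := fun f hf => by
    refine (normB_superposition_le hg hC h (hSB hf).1).trans ?_
    gcongr
    exact hSR f hf
  have hfin : ‖g 0‖ₑ + 3 * ENNReal.ofReal C + 3 * ENNReal.ofReal C * R < ⊤ := by finiteness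
  refine ⟨?_, _, hfin, ?_⟩
  · rintro _ ⟨f, hf, rfl⟩
    refine ⟨?_, (hb f hf).trans_lt hfin⟩
    rw [locallyIntegrable_iff]
    intro K hK
    exact integrableOn_superposition hg hC h hK.measure_lt_top.ne
      ((hSB hf).1.integrableOn_isCompact hK)
  · rintro _ ⟨f, hf, rfl⟩
    exact hb f hf

lemma HasLinearIncrements.isBoundedInBUnit_image (hl : HasLinearIncrements g) (hg : Measurable g)
    {S : Set ((Fin n → ℝ) → ℂ)} (hS : IsBoundedInBUnit S) :
    IsBoundedInBUnit (superposition g '' S) := by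
  obtain ⟨C, hC, h⟩ := hl.exists_bound
  obtain ⟨hSB, R, hR, hSR⟩ := hS
  have hb : ∀ f ∈ S, normBUnit (superposition g f) ≤
      ‖g 0‖ₑ + 3 * ENNReal.ofReal C + 3 * ENNReal.ofReal C * R := fun f hf => by
    refine (normBUnit_superposition_le hg hC h (hSB hf).1).trans ?_
    gcongr
    exact hSR f hf
  have hfin : ‖g 0‖ₑ + 3 * ENNReal.ofReal C + 3 * ENNReal.ofReal C * R < ⊤ := by finiteness
  refine ⟨?_, _, hfin, ?_⟩
  · rintro _ ⟨f, hf, rfl⟩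
    refine ⟨integrableOn_superposition hg hC h ?_ (hSB hf).1, (hb f hf).trans_lt hfin⟩
    rw [unitCube_eq_cube]
    exact volume_cube_ne_top _ _
  · rintro _ ⟨f, hf, rfl⟩
    exact hb f hf

lemma HasLinearIncrements.mapsTo_B (hl : HasLinearIncrements g) (hg : Measurable g) :
    MapsTo (superposition g) (B n) (B n) := fun f hf =>
  (hl.isBoundedInB_image hg (S := {f}) ⟨by simpa using hf, normB f, hf.2, by simp⟩).1
    ⟨f, rfl, rfl⟩

lemma HasLinearIncrements.mapsTo_BUnit (hl : HasLinearIncrements g) (hg : Measurable g) :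
    MapsTo (superposition g) (BUnit n) (BUnit n) := fun f hf =>
  (hl.isBoundedInBUnit_image hg (S := {f}) ⟨by simpa using hf, normBUnit f, hf.2, by simp⟩).1
    ⟨f, rfl, rfl⟩

end Sufficiency

/-! ### Test functions -/

section TestFunctions

variable {n : ℕ} {Ω : Set (Fin n → ℝ)}

lemma add_mem_testFunctions {φ ψ : (Fin n → ℝ) → ℂ} (hφ : φ ∈ testFunctions Ω)
    (hψ : ψ ∈ testFunctions Ω) : (fun x => φ x + ψ x) ∈ testFunctions Ω :=
  ⟨hφ.1.add hψ.1, hφ.2.1.add hψ.2.1, (tsupport_add φ ψ).trans (union_subset hφ.2.2 hψ.2.2)⟩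

lemma const_mul_mem_testFunctions (c : ℂ) {φ : (Fin n → ℝ) → ℂ} (hφ : φ ∈ testFunctions Ω) :
    (fun x => c * φ x) ∈ testFunctions Ω :=
  ⟨contDiff_const.mul hφ.1, hφ.2.1.mul_left,
    (tsupport_mul_subset_right (f := fun _ => c)).trans hφ.2.2⟩

lemma sum_mem_testFunctions {ι : Type*} {u : ι → (Fin n → ℝ) → ℂ} (s : Finset ι)
    (h : ∀ j ∈ s, u j ∈ testFunctions Ω) : (fun x => ∑ j ∈ s, u j x) ∈ testFunctions Ω := by
  classical
  induction s using Finset.induction_on with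
  | empty =>
    simp only [Finset.sum_empty]
    exact ⟨contDiff_const, HasCompactSupport.zero, by simp [tsupport]⟩
  | insert j s hj ih =>
    simp only [Finset.sum_insert hj]
    exact add_mem_testFunctions (h j (by simp)) (ih fun i hi => h i (by simp [hi]))

end TestFunctions

/-! ### Bumps concentrated on slabs -/

section Slab

/-- The map `x ↦ 6 * x / (1 + x)` increases by at least `min x x⁻¹` when `x` is doubled. -/
lemma min_le_telescope {x : ℝ} (hx : 0 < x) :
    min x x⁻¹ ≤ 6 * (2 * x / (1 + 2 * x)) - 6 * (x / (1 + x)) := by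
  have h : 6 * (2 * x / (1 + 2 * x)) - 6 * (x / (1 + x)) = 6 * x / ((1 + 2 * x) * (1 + x)) := by
    field_simp
    ring
  rw [h, le_div_iff₀ (by positivity)]
  rcases le_total x 1 with h1 | h1
  · calc min x x⁻¹ * ((1 + 2 * x) * (1 + x)) ≤ x * ((1 + 2 * 1) * (1 + 1)) := by
          gcongr
          exact min_le_left _ _
      _ = 6 * x := by ring
  · calc min x x⁻¹ * ((1 + 2 * x) * (1 + x)) ≤ x⁻¹ * ((x + 2 * x) * (x + x)) := by
          gcongr
          exact min_le_right _ _
      _ = 6 * x := by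
          field_simp
          ring

/-- Along a dyadic sequence the quantities `min x x⁻¹` have a sum bounded independently of the
starting point and of the number of terms. -/
lemma sum_min_two_pow_le {t : ℝ} (ht : 0 < t) (m : ℕ) :
    ∑ j ∈ Finset.range m, min (t * 2 ^ j) (t * 2 ^ j)⁻¹ ≤ 6 := by
  have h : ∀ m : ℕ, ∑ j ∈ Finset.range m, min (t * 2 ^ j) (t * 2 ^ j)⁻¹ ≤
      6 * (t * 2 ^ m / (1 + t * 2 ^ m)) - 6 * (t / (1 + t)) := by
    intro m
    induction m with
    | zero => simp
    | succ m ih =>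
      rw [Finset.sum_range_succ]
      have h1 := min_le_telescope (x := t * 2 ^ m) (by positivity)
      have h2 : t * 2 ^ (m + 1) = 2 * (t * 2 ^ m) := by ring
      rw [h2]
      linarith
  have h3 : t * 2 ^ m / (1 + t * 2 ^ m) ≤ 1 := by
    rw [div_le_one (by positivity)]
    linarith
  have h4 : 0 ≤ t / (1 + t) := by positivity
  linarith [h m]

/-- A smooth cutoff supported in the unit cube, equal to `1` on `[1/4, 3/4]ⁿ`. -/
noncomputable def cutoff (n : ℕ) : ContDiffBump (fun _ : Fin n => (1 / 2 : ℝ)) :=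
  ⟨1 / 4, 3 / 8, by norm_num, by norm_num⟩

/-- A smooth profile on the line, equal to `1` on `[-1, 1]` and supported in `[-2, 2]`. -/
noncomputable def profile : ContDiffBump (0 : ℝ) :=
  ⟨1, 2, by norm_num, by norm_num⟩

variable {d : ℕ}

/-- A smooth bump concentrated on the slab of points whose first coordinate is at distance at most
`2 * r` from `c`, cut off to the unit cube. -/
noncomputable def slabBump (c r : ℝ) (x : Fin (d + 1) → ℝ) : ℂ :=
  ((cutoff (d + 1) x * profile ((x 0 - c) / r) : ℝ) : ℂ)

lemma contDiff_slabBump (c r : ℝ) : ContDiff ℝ ∞ (slabBump (d := d) c r) := by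
  refine Complex.ofRealCLM.contDiff.comp ((cutoff (d + 1)).contDiff.mul (profile.contDiff.comp ?_))
  simp only [div_eq_mul_inv]
  fun_prop

lemma slabBump_mem_testFunctions (c r : ℝ) :
    slabBump (d := d) c r ∈ testFunctions (unitCube (d + 1)) := by
  have hsupp : tsupport (slabBump (d := d) c r) ⊆ tsupport (cutoff (d + 1)) := by
    refine closure_mono fun x hx => ?_
    rw [Function.mem_support] at hx ⊢
    intro h
    exact hx (by simp [slabBump, h])
  refine ⟨contDiff_slabBump c r, ?_, hsupp.trans ?_⟩
  · exact (cutoff (d + 1)).hasCompactSupport.isCompact.of_isClosed_subset (isClosed_tsupport _) hsupp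
  · rw [ContDiffBump.tsupport_eq]
    intro x hx i _
    have h1 : dist x (fun _ => (1 / 2 : ℝ)) ≤ 3 / 8 := hx
    have h2 := (dist_le_pi_dist x (fun _ => (1 / 2 : ℝ)) i).trans h1
    rw [Real.dist_eq, abs_le] at h2
    constructor <;> linarith [h2.1, h2.2]

lemma slabBump_eq_one {c r : ℝ} (hr : 0 < r) {x : Fin (d + 1) → ℝ}
    (hx : x ∈ Metric.closedBall (fun _ : Fin (d + 1) => (1 / 2 : ℝ)) (1 / 4))
    (hc : |x 0 - c| ≤ r) : slabBump c r x = 1 := by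
  have h1 : cutoff (d + 1) x = 1 := (cutoff (d + 1)).one_of_mem_closedBall hx
  have h2 : profile ((x 0 - c) / r) = 1 := by
    refine profile.one_of_mem_closedBall ?_
    rw [mem_closedBall_zero_iff, Real.norm_eq_abs, abs_div, abs_of_pos hr]
    exact (div_le_one hr).2 hc
  simp [slabBump, h1, h2]

lemma slabBump_eq_zero {c r : ℝ} (hr : 0 < r) {x : Fin (d + 1) → ℝ} (hc : 2 * r ≤ |x 0 - c|) :
    slabBump c r x = 0 := by
  have h2 : profile ((x 0 - c) / r) = 0 := by
    refine profile.zero_of_le_dist ?_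
    rw [dist_zero_right, Real.norm_eq_abs, abs_div, abs_of_pos hr]
    exact (le_div_iff₀ hr).2 hc
  simp [slabBump, h2]

lemma norm_slabBump_le_one (c r : ℝ) (x : Fin (d + 1) → ℝ) : ‖slabBump c r x‖ ≤ 1 := by
  rw [slabBump, Complex.norm_real, norm_mul, Real.norm_of_nonneg (ContDiffBump.nonneg _),
    Real.norm_of_nonneg (ContDiffBump.nonneg _)]
  exact mul_le_one₀ (ContDiffBump.le_one _) (ContDiffBump.nonneg _) (ContDiffBump.le_one _)

lemma slabBump_eq_zero_of_notMem (c r : ℝ) {x : Fin (d + 1) → ℝ} (hx : x ∉ unitCube (d + 1)) :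
    slabBump c r x = 0 :=
  image_eq_zero_of_notMem_tsupport fun h => hx ((slabBump_mem_testFunctions c r).2.2 h)

lemma measurable_slabBump (c r : ℝ) : Measurable (slabBump (d := d) c r) :=
  (contDiff_slabBump c r).continuous.measurable

lemma exists_lipschitz_slabBump (d : ℕ) : ∃ K : ℝ, 0 ≤ K ∧ ∀ (c r : ℝ), 0 < r → r ≤ 1 →
    ∀ x y : Fin (d + 1) → ℝ, ‖slabBump c r x - slabBump c r y‖ ≤ K / r * dist x y := by
  obtain ⟨K₁, h₁⟩ := ContDiff.lipschitzWith_of_hasCompactSupport (n := ∞)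
    (cutoff (d + 1)).hasCompactSupport (cutoff (d + 1)).contDiff (by simp)
  obtain ⟨K₂, h₂⟩ := ContDiff.lipschitzWith_of_hasCompactSupport (n := ∞)
    profile.hasCompactSupport profile.contDiff (by simp)
  refine ⟨K₁ + K₂, by positivity, fun c r hr hr1 x y => ?_⟩
  set p := profile ((x 0 - c) / r)
  set q := profile ((y 0 - c) / r)
  have e : slabBump c r x - slabBump c r y =
      (((cutoff (d + 1) x - cutoff (d + 1) y) * p + cutoff (d + 1) y * (p - q) : ℝ) : ℂ) := by
    rw [slabBump, slabBump, ← Complex.ofReal_sub]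
    congr 1
    ring
  have b₁ : |cutoff (d + 1) x - cutoff (d + 1) y| ≤ K₁ * dist x y := by
    rw [← Real.dist_eq]
    exact h₁.dist_le_mul x y
  have b₂ : |p - q| ≤ K₂ * (dist x y / r) := by
    rw [← Real.dist_eq]
    refine (h₂.dist_le_mul _ _).trans ?_
    gcongr
    rw [Real.dist_eq, ← sub_div, sub_sub_sub_cancel_right, abs_div, abs_of_pos hr]
    gcongr
    rw [← Real.dist_eq]
    exact dist_le_pi_dist x y 0
  have hp : |p| ≤ 1 := by
    rw [abs_of_nonneg (ContDiffBump.nonneg _)]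
    exact ContDiffBump.le_one _
  have hq : |cutoff (d + 1) y| ≤ 1 := by
    rw [abs_of_nonneg (ContDiffBump.nonneg _)]
    exact ContDiffBump.le_one _
  rw [e, Complex.norm_real, Real.norm_eq_abs]
  calc _ ≤ |cutoff (d + 1) x - cutoff (d + 1) y| * |p| + |cutoff (d + 1) y| * |p - q| := by
        rw [← abs_mul, ← abs_mul]
        exact abs_add_le _ _
    _ ≤ (K₁ * dist x y) * 1 + 1 * (K₂ * (dist x y / r)) := by gcongr
    _ ≤ (K₁ * (dist x y / r)) * 1 + 1 * (K₂ * (dist x y / r)) := by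
        gcongr
        exact le_div_self dist_nonneg hr hr1
    _ = _ := by ring

lemma volume_cube_inter_slab_le (a : Fin (d + 1) → ℝ) (s c ρ : ℝ) :
    volume (cube a s ∩ {x | |x 0 - c| < ρ}) ≤ ENNReal.ofReal (2 * ρ) * ENNReal.ofReal s ^ d := by
  have hsub : cube a s ∩ {x | |x 0 - c| < ρ} ⊆ univ.pi fun i : Fin (d + 1) =>
      Ioo ((Fin.cons (c - ρ) fun i : Fin d => a i.succ - s / 2 : Fin (d + 1) → ℝ) i)
        ((Fin.cons (c + ρ) fun i : Fin d => a i.succ + s / 2 : Fin (d + 1) → ℝ) i) := by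
    rintro x ⟨hx, hc⟩ i -
    rw [mem_ofPred_eq, abs_lt] at hc
    refine Fin.cases ?_ (fun i => ?_) i
    · simp only [Fin.cons_zero]
      constructor <;> linarith [hc.1, hc.2]
    · simpa using hx i.succ (mem_univ _)
  refine (measure_mono hsub).trans_eq ?_
  rw [Real.volume_pi_Ioo, Fin.prod_univ_succ]
  simp only [Fin.cons_zero, Fin.cons_succ, add_sub_sub_cancel, add_halves, Finset.prod_const,
    Finset.card_univ, Fintype.card_fin]
  rw [two_mul]

lemma enorm_slabBump_le_indicator {c r : ℝ} (hr : 0 < r) (x : Fin (d + 1) → ℝ) :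
    ‖slabBump c r x‖ₑ ≤ {x : Fin (d + 1) → ℝ | |x 0 - c| < 2 * r}.indicator 1 x := by
  by_cases hx : |x 0 - c| < 2 * r
  · rw [indicator_of_mem (by exact hx), Pi.one_apply, ← ofReal_norm, ← ENNReal.ofReal_one]
    exact ENNReal.ofReal_le_ofReal (norm_slabBump_le_one c r x)
  · rw [slabBump_eq_zero hr (not_lt.1 hx)]
    simp

lemma setLIntegral_slabBump_le {c r : ℝ} (hr : 0 < r) (a : Fin (d + 1) → ℝ) (s : ℝ) :
    ∫⁻ x in cube a s, ‖slabBump c r x‖ₑ ≤ ENNReal.ofReal (4 * r) * ENNReal.ofReal s ^ d := by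
  have hm : MeasurableSet {x : Fin (d + 1) → ℝ | |x 0 - c| < 2 * r} :=
    measurableSet_lt (by fun_prop) (by fun_prop)
  refine (lintegral_mono (enorm_slabBump_le_indicator hr)).trans ?_
  rw [lintegral_indicator_one hm, Measure.restrict_apply hm, inter_comm]
  refine (volume_cube_inter_slab_le a s c (2 * r)).trans_eq ?_
  ring_nf

lemma lintegral_slabBump_le {c r : ℝ} (hr : 0 < r) :
    ∫⁻ x, ‖slabBump (d := d) c r x‖ₑ ≤ ENNReal.ofReal (4 * r) := by
  have h := setLIntegral_slabBump_le (d := d) (c := c) hr (fun _ => 1 / 2) 1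
  rw [ENNReal.ofReal_one, one_pow, mul_one, ← unitCube_eq_cube] at h
  rwa [setLIntegral_eq_of_support_subset] at h
  intro x hx
  by_contra hx'
  exact hx (by simp [slabBump_eq_zero_of_notMem c r hx'])

lemma integrable_slabBump (c r : ℝ) : Integrable (slabBump (d := d) c r) :=
  (contDiff_slabBump c r).continuous.integrable_of_hasCompactSupport
    (slabBump_mem_testFunctions c r).2.1

/-- A bump of width `r` oscillates little on cubes much smaller than `r`, where it is nearly
constant, and on cubes much larger than `r`, of which its support fills a small part. -/
lemma exists_meanOsc_slabBump_le (d : ℕ) : ∃ K : ℝ, 0 ≤ K ∧ ∀ (c r : ℝ), 0 < r → r ≤ 1 →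
    ∀ (a : Fin (d + 1) → ℝ) (s : ℝ), 0 < s →
      meanOsc (slabBump c r) (cube a s) ≤ ENNReal.ofReal (K * min (s / r) (s / r)⁻¹) := by
  obtain ⟨K, hK, hL⟩ := exists_lipschitz_slabBump d
  refine ⟨2 * K + 8, by positivity, fun c r hr hr1 a s hs => ?_⟩
  have hint := (integrable_slabBump (d := d) c r).integrableOn (s := cube a s)
  have := isProbabilityMeasure_avgMeasure a hs
  have h₁ : meanOsc (slabBump c r) (cube a s) ≤ ENNReal.ofReal (2 * K * (s / r)) := by
    refine (meanOsc_le_two_mul hs hint (slabBump c r a)).trans ?_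
    have h : ∫⁻ x, ‖slabBump c r x - slabBump c r a‖ₑ ∂avgMeasure (cube a s) ≤
        ∫⁻ _, ENNReal.ofReal (K * (s / r)) ∂avgMeasure (cube a s) := by
      refine lintegral_mono_ae (Measure.ae_smul_measure ?_ _)
      refine ae_restrict_of_forall_mem (measurableSet_cube a s) fun x hx => ?_
      rw [← ofReal_norm]
      refine ENNReal.ofReal_le_ofReal ((hL c r hr hr1 x a).trans ?_)
      have hd : dist x a ≤ s := by
        rw [dist_pi_le_iff hs.le]
        intro i
        have := hx i (mem_univ i)
        rw [Real.dist_eq, abs_le]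
        constructor <;> linarith [this.1, this.2]
      calc K / r * dist x a ≤ K / r * s := by gcongr
        _ = K * (s / r) := by ring
    rw [lintegral_const, measure_univ, mul_one] at h
    rw [mul_assoc, ENNReal.ofReal_mul (by norm_num : (0 : ℝ) ≤ 2)]
    simpa using mul_le_mul_right h 2
  have h₂ : meanOsc (slabBump c r) (cube a s) ≤ ENNReal.ofReal (8 * (s / r)⁻¹) := by
    refine (meanOsc_le_two_mul hs hint 0).trans ?_
    simp only [sub_zero]
    rw [lintegral_smul_measure, volume_cube, smul_eq_mul]
    calc 2 * ((ENNReal.ofReal s ^ (d + 1))⁻¹ * ∫⁻ x in cube a s, ‖slabBump c r x‖ₑ)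
        ≤ 2 * ((ENNReal.ofReal s ^ (d + 1))⁻¹ *
            (ENNReal.ofReal (4 * r) * ENNReal.ofReal s ^ d)) := by
          gcongr
          exact setLIntegral_slabBump_le hr a s
      _ = ENNReal.ofReal (2 * ((s ^ (d + 1))⁻¹ * (4 * r * s ^ d))) := by
          rw [ENNReal.ofReal_mul (p := 2) (by norm_num),
            ENNReal.ofReal_mul (p := (s ^ (d + 1))⁻¹) (by positivity),
            ENNReal.ofReal_mul (p := 4 * r) (q := s ^ d) (by positivity), ENNReal.ofReal_inv_of_pos
            (by positivity), ENNReal.ofReal_pow hs.le, ENNReal.ofReal_pow hs.le,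
            ENNReal.ofReal_ofNat]
      _ = ENNReal.ofReal (8 * (s / r)⁻¹) := by
          congr 1
          field_simp
          ring
  have hsr : 0 < s / r := by positivity
  rcases min_choice (s / r) (s / r)⁻¹ with h | h <;> rw [h]
  · refine h₁.trans (ENNReal.ofReal_le_ofReal ?_)
    gcongr
    linarith
  · refine h₂.trans (ENNReal.ofReal_le_ofReal ?_)
    gcongr
    linarith

lemma hasOscBound_slabBump (c : ℝ) {r : ℝ} (hr : 0 < r) (hr1 : r ≤ 1) :
    HasOscBound (slabBump (d := d) c r) 4 := by
  refine ⟨measurable_slabBump c r, (lintegral_slabBump_le hr).trans ?_, fun a s hs => ?_⟩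
  · rw [← ENNReal.ofReal_ofNat]
    exact ENNReal.ofReal_le_ofReal (by linarith)
  · have := isProbabilityMeasure_avgMeasure a hs
    refine (meanOsc_le_two_mul hs (integrable_slabBump c r).integrableOn 0).trans ?_
    have h : ∫⁻ x, ‖slabBump c r x - 0‖ₑ ∂avgMeasure (cube a s) ≤
        ∫⁻ _, 1 ∂avgMeasure (cube a s) := by
      refine lintegral_mono fun x => ?_
      rw [sub_zero, ← ofReal_norm, ← ENNReal.ofReal_one]
      exact ENNReal.ofReal_le_ofReal (norm_slabBump_le_one c r x)
    rw [lintegral_const, measure_univ, mul_one] at h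
    calc _ ≤ 2 * (1 : ℝ≥0∞) := by gcongr
      _ ≤ 4 := by norm_num

/-- The average of `m` bumps whose widths `r, r/2, r/4, …` decrease dyadically: a smooth
truncation of a logarithm. -/
noncomputable def logBump (c r : ℝ) (m : ℕ) (x : Fin (d + 1) → ℝ) : ℂ :=
  (m : ℂ)⁻¹ * ∑ j ∈ Finset.range m, slabBump c (r / 2 ^ j) x

lemma logBump_eq_one {c r : ℝ} (hr : 0 < r) {m : ℕ} (hm : m ≠ 0) {x : Fin (d + 1) → ℝ}
    (hx : x ∈ Metric.closedBall (fun _ : Fin (d + 1) => (1 / 2 : ℝ)) (1 / 4))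
    (hc : |x 0 - c| ≤ r / 2 ^ m) : logBump c r m x = 1 := by
  have h : ∀ j ∈ Finset.range m, slabBump c (r / 2 ^ j) x = 1 := fun j hj => by
    refine slabBump_eq_one (by positivity) hx (hc.trans ?_)
    gcongr
    · norm_num
    · exact (Finset.mem_range.1 hj).le
  have hm' : (m : ℂ) ≠ 0 := by exact_mod_cast hm
  simp [logBump, Finset.sum_congr rfl h, hm']

lemma logBump_eq_zero {c r : ℝ} (hr : 0 < r) (m : ℕ) {x : Fin (d + 1) → ℝ}
    (hc : 2 * r ≤ |x 0 - c|) : logBump c r m x = 0 := by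
  have h : ∀ j ∈ Finset.range m, slabBump c (r / 2 ^ j) x = 0 := fun j _ => by
    refine slabBump_eq_zero (by positivity) (le_trans ?_ hc)
    gcongr
    exact div_le_self hr.le (one_le_pow₀ (by norm_num))
  simp [logBump, Finset.sum_congr rfl h]

/-- The averaged bumps have mean oscillation `O(1/m)` because at each scale only boundedly many of
them oscillate. -/
lemma exists_hasOscBound_logBump (d : ℕ) : ∃ K : ℝ, 0 ≤ K ∧ ∀ (c r : ℝ), 0 < r → r ≤ 1 →
    ∀ m : ℕ, HasOscBound (logBump (d := d) c r m) (ENNReal.ofReal (K / m)) := by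
  obtain ⟨K, hK, hosc⟩ := exists_meanOsc_slabBump_le d
  refine ⟨6 * K + 8, by positivity, fun c r hr hr1 m => ?_⟩
  have hrj : ∀ j : ℕ, 0 < r / 2 ^ j := fun j => by positivity
  have hrj1 : ∀ j : ℕ, r / 2 ^ j ≤ 1 := fun j =>
    (div_le_self hr.le (one_le_pow₀ (by norm_num))).trans hr1
  have hmeas : Measurable fun x : Fin (d + 1) → ℝ =>
      ∑ j ∈ Finset.range m, slabBump c (r / 2 ^ j) x :=
    Finset.measurable_sum _ fun j _ => measurable_slabBump _ _
  have hbase : HasOscBound (fun x : Fin (d + 1) → ℝ =>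
      ∑ j ∈ Finset.range m, slabBump c (r / 2 ^ j) x) (ENNReal.ofReal (6 * K + 8)) := by
    refine ⟨hmeas, ?_, fun a s hs => ?_⟩
    · calc ∫⁻ x : Fin (d + 1) → ℝ, ‖∑ j ∈ Finset.range m, slabBump c (r / 2 ^ j) x‖ₑ
          ≤ ∫⁻ x : Fin (d + 1) → ℝ, ∑ j ∈ Finset.range m, ‖slabBump c (r / 2 ^ j) x‖ₑ :=
            lintegral_mono fun x => enorm_sum_le _ _
        _ = ∑ j ∈ Finset.range m, ∫⁻ x : Fin (d + 1) → ℝ, ‖slabBump c (r / 2 ^ j) x‖ₑ :=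
            lintegral_finsetSum _ fun j _ => (measurable_slabBump _ _).enorm
        _ ≤ ∑ j ∈ Finset.range m, ENNReal.ofReal (4 * (r / 2 ^ j)) :=
            Finset.sum_le_sum fun j _ => lintegral_slabBump_le (hrj j)
        _ = ENNReal.ofReal (∑ j ∈ Finset.range m, 4 * (r / 2 ^ j)) :=
            (ENNReal.ofReal_sum_of_nonneg fun j _ => by positivity).symm
        _ ≤ ENNReal.ofReal (6 * K + 8) := by
            refine ENNReal.ofReal_le_ofReal ?_
            have h1 := sum_geometric_two_le m
            have h2 : ∑ j ∈ Finset.range m, 4 * (r / 2 ^ j) =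
                4 * r * ∑ j ∈ Finset.range m, (1 / (2 : ℝ)) ^ j := by
              rw [Finset.mul_sum]
              refine Finset.sum_congr rfl fun j _ => ?_
              rw [one_div, inv_pow]
              ring
            rw [h2]
            nlinarith
    · have hsum : (fun x : Fin (d + 1) → ℝ => ∑ j ∈ Finset.range m, slabBump c (r / 2 ^ j) x) =
          fun x => ∑' j : Fin m, slabBump c (r / 2 ^ (j : ℕ)) x := by
        funext x
        rw [tsum_fintype, Finset.sum_range]
      rw [hsum]
      calc _ ≤ ∑' j : Fin m, meanOsc (slabBump c (r / 2 ^ (j : ℕ))) (cube a s) := by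
            refine meanOsc_tsum_le (fun j => measurable_slabBump _ _) ?_
              (fun x => (hasSum_fintype _).summable) hs
            rw [tsum_fintype]
            exact ENNReal.sum_ne_top.2 fun j _ =>
              ne_top_of_le_ne_top ENNReal.ofReal_ne_top (lintegral_slabBump_le (hrj j))
        _ = ∑ j ∈ Finset.range m, meanOsc (slabBump c (r / 2 ^ j)) (cube a s) := by
            rw [tsum_fintype,
              Finset.sum_range fun j => meanOsc (slabBump c (r / 2 ^ j)) (cube a s)]
        _ ≤ ∑ j ∈ Finset.range m,
              ENNReal.ofReal (K * min (s / (r / 2 ^ j)) (s / (r / 2 ^ j))⁻¹) :=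
            Finset.sum_le_sum fun j _ => hosc c _ (hrj j) (hrj1 j) a s hs
        _ = ENNReal.ofReal (∑ j ∈ Finset.range m,
              K * min (s / (r / 2 ^ j)) (s / (r / 2 ^ j))⁻¹) :=
            (ENNReal.ofReal_sum_of_nonneg fun j _ => by positivity).symm
        _ ≤ ENNReal.ofReal (6 * K + 8) := by
            refine ENNReal.ofReal_le_ofReal ?_
            have h1 := sum_min_two_pow_le (t := s / r) (by positivity) m
            have h2 : ∀ j : ℕ, s / (r / 2 ^ j) = s / r * 2 ^ j := fun j => by field_simp
            simp_rw [h2]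
            rw [← Finset.mul_sum]
            nlinarith
  have h := hbase.const_mul ((m : ℂ)⁻¹)
  refine h.mono (le_of_eq ?_)
  rw [← ofReal_norm, ← ENNReal.ofReal_mul (norm_nonneg _), norm_inv, Complex.norm_natCast,
    div_eq_inv_mul]

lemma logBump_mem_testFunctions (c r : ℝ) (m : ℕ) :
    logBump (d := d) c r m ∈ testFunctions (unitCube (d + 1)) :=
  const_mul_mem_testFunctions _ (sum_mem_testFunctions _ fun _ _ => slabBump_mem_testFunctions _ _)

end Slab

/-! ### Large jumps of `g` over short distances -/

/-- If `g` does not have linear increments, it jumps by arbitrarily large amounts between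
arbitrarily close points: otherwise, subdividing a segment would bound its increments linearly. -/
lemma exists_large_jump {g : ℂ → ℂ} (hg : ¬ HasLinearIncrements g) {δ : ℝ} (hδ : 0 < δ) (A : ℝ) :
    ∃ x y, ‖x - y‖ ≤ δ ∧ A ≤ ‖g x - g y‖ := by
  by_contra! h
  have hA : 0 ≤ A := by simpa using (h 0 0 (by simpa using hδ.le)).le
  refine hg ⟨A * (1 + 1 / δ), ?_⟩
  rintro _ ⟨⟨x, y⟩, rfl⟩
  simp only []
  rw [inv_mul_le_iff₀ (by positivity)]
  set N := ⌈‖x - y‖ / δ⌉₊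
  have hN : ‖x - y‖ / δ ≤ N := Nat.le_ceil _
  have hN' : (N : ℝ) ≤ ‖x - y‖ / δ + 1 := (Nat.ceil_lt_add_one (by positivity)).le
  let z : ℕ → ℂ := fun i => x + ((i : ℂ) / N) * (y - x)
  have hz : ∀ i, ‖g (z i) - g (z (i + 1))‖ ≤ A := fun i => by
    refine (h _ _ ?_).le
    have e : z i - z (i + 1) = (x - y) / N := by
      simp only [z]
      push_cast
      ring
    rw [e, norm_div, Complex.norm_natCast]
    rcases Nat.eq_zero_or_pos N with h0 | h0
    · simp [h0, hδ.le]
    · rw [div_le_iff₀ (by exact_mod_cast h0)]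
      rwa [div_le_iff₀ hδ, mul_comm] at hN
  have hz0 : z 0 = x := by simp [z]
  have hzN : z N = y := by
    rcases Nat.eq_zero_or_pos N with h0 | h0
    · have h1 : ‖x - y‖ / δ ≤ 0 := by simpa [h0] using hN
      rw [div_le_iff₀ hδ, zero_mul, norm_le_zero_iff, sub_eq_zero] at h1
      simp [z, h1]
    · have h1 : (N : ℂ) ≠ 0 := by exact_mod_cast h0.ne'
      simp [z, div_self h1]
  have hsum := dist_le_range_sum_dist (fun i => g (z i)) N
  simp only [hz0, hzN, dist_eq_norm] at hsum
  calc ‖g x - g y‖ ≤ ∑ i ∈ Finset.range N, ‖g (z i) - g (z (i + 1))‖ := hsum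
    _ ≤ ∑ i ∈ Finset.range N, A := Finset.sum_le_sum fun i _ => hz i
    _ = N * A := by simp
    _ ≤ (‖x - y‖ / δ + 1) * A := by gcongr
    _ ≤ (1 + ‖x - y‖) * (A * (1 + 1 / δ)) := by
      have h1 : 0 ≤ A * (1 / δ + ‖x - y‖) := by positivity
      have h2 : (1 + ‖x - y‖) * (A * (1 + 1 / δ)) =
        (‖x - y‖ / δ + 1) * A + A * (1 / δ + ‖x - y‖) := by ring
      linarith

/-! ### A lower bound for the oscillation across a hyperplane -/

section LowerBound

variable {d : ℕ}

/-- The centres of the `ε`-cubes, `ε = 1 / (2 * M)`, that tile the part of the slab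
`|x₀ - c| < ε / 2` whose other coordinates lie in `[1/4, 3/4]`. -/
noncomputable def slabCentre (c : ℝ) (M : ℕ) (l : Fin d → Fin M) : Fin (d + 1) → ℝ :=
  Fin.cons c fun i => 1 / 4 + (1 / (2 * M : ℝ)) / 2 + 1 / (2 * M : ℝ) * (l i : ℕ)

lemma cube_slabCentre_subset {c : ℝ} {M : ℕ} (hc : |c - 1 / 2| + 1 / (2 * M : ℝ) / 2 ≤ 1 / 4)
    (l : Fin d → Fin M) : cube (slabCentre c M l) (1 / (2 * M)) ⊆
      Metric.closedBall (fun _ : Fin (d + 1) => (1 / 2 : ℝ)) (1 / 4) := by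
  intro x hx
  rw [Metric.mem_closedBall, dist_pi_le_iff (by norm_num)]
  intro i
  have hi := hx i (mem_univ i)
  rw [Real.dist_eq, abs_le]
  revert hi
  refine Fin.cases (fun hi => ?_) (fun i hi => ?_) i
  · simp only [slabCentre, Fin.cons_zero] at hi
    have h1 := le_abs_self (c - 1 / 2)
    have h2 := neg_le_abs (c - 1 / 2)
    constructor <;> linarith [hi.1, hi.2]
  · simp only [slabCentre, Fin.cons_succ] at hi
    have hM : (0 : ℝ) < M := by exact_mod_cast (l i).pos
    have hl : ((l i : ℕ) : ℝ) + 1 ≤ M := by exact_mod_cast (l i).2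
    have h1 : 1 / (2 * M : ℝ) * ((l i : ℕ) + 1) ≤ 1 / (2 * M : ℝ) * M := by gcongr
    have h2 : 1 / (2 * M : ℝ) * M = 1 / 2 := by field_simp
    have h3 : 0 ≤ 1 / (2 * M : ℝ) * (l i : ℕ) := by positivity
    constructor <;> linarith [hi.1, hi.2]

lemma disjoint_cube_slabCentre (c : ℝ) {M : ℕ} {l l' : Fin d → Fin M} (h : l ≠ l') :
    Disjoint (cube (slabCentre c M l) (1 / (2 * M))) (cube (slabCentre c M l') (1 / (2 * M))) := by
  obtain ⟨i, hi⟩ := Function.ne_iff.1 h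
  rw [disjoint_left]
  intro x hx hx'
  have h1 := hx i.succ (mem_univ _)
  have h2 := hx' i.succ (mem_univ _)
  simp only [slabCentre, Fin.cons_succ] at h1 h2
  have hM : (0 : ℝ) < M := by exact_mod_cast (l i).pos
  have hpos : 0 ≤ 1 / (2 * M : ℝ) := by positivity
  rcases lt_or_gt_of_ne (fun e => hi (Fin.ext e) : (l i : ℕ) ≠ l' i) with h3 | h3
  · have h4 : ((l i : ℕ) : ℝ) + 1 ≤ (l' i : ℕ) := by exact_mod_cast h3
    have h5 := mul_le_mul_of_nonneg_left h4 hpos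
    linarith [h1.1, h1.2, h2.1, h2.2]
  · have h4 : ((l' i : ℕ) : ℝ) + 1 ≤ (l i : ℕ) := by exact_mod_cast h3
    have h5 := mul_le_mul_of_nonneg_left h4 hpos
    linarith [h1.1, h1.2, h2.1, h2.2]

lemma closedBall_subset_unitCube {n : ℕ} :
    Metric.closedBall (fun _ : Fin n => (1 / 2 : ℝ)) (1 / 4) ⊆ unitCube n := by
  intro x hx i _
  have h2 := (dist_le_pi_dist x (fun _ => (1 / 2 : ℝ)) i).trans hx
  rw [Real.dist_eq, abs_le] at h2
  constructor <;> linarith [h2.1, h2.2]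

/-- A function that equals `v` near the hyperplane `x₀ = c` and `u` at distance `ε / 4` to `ε / 2`
from it oscillates by a fixed multiple of `|u - v|` on each of the `(2 * ε) ^ (1 - n)` cubes of
side `ε` centred on the hyperplane. -/
lemma le_oscSum_of_jump {f : (Fin (d + 1) → ℝ) → ℂ} {c : ℝ} {M : ℕ} (hM : M ≠ 0) {u v : ℂ}
    (hc : |c - 1 / 2| + 1 / (2 * M : ℝ) / 2 ≤ 1 / 4)
    (hu : ∀ x ∈ Metric.closedBall (fun _ : Fin (d + 1) => (1 / 2 : ℝ)) (1 / 4),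
      1 / (2 * M : ℝ) / 4 ≤ |x 0 - c| → |x 0 - c| ≤ 1 / (2 * M : ℝ) / 2 → f x = u)
    (hv : ∀ x ∈ Metric.closedBall (fun _ : Fin (d + 1) => (1 / 2 : ℝ)) (1 / 4),
      |x 0 - c| ≤ 1 / (2 * M : ℝ) / 8 → f x = v) :
    ENNReal.ofReal ((1 / 2) ^ d * (1 / 4) ^ (d + 1) * ‖u - v‖) ≤
      oscSum (unitCube (d + 1)) (1 / (2 * M)) f := by
  classical
  have hM0 : (0 : ℝ) < M := by exact_mod_cast Nat.pos_of_ne_zero hM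
  set ε : ℝ := 1 / (2 * M : ℝ) with hε_def
  have hε : 0 < ε := by positivity
  have hεM : ε * M = 1 / 2 := by
    rw [hε_def]
    field_simp
  have hinj : Function.Injective (slabCentre (d := d) c M) := by
    intro l l' h
    by_contra hne
    have h1 := disjoint_cube_slabCentre c hne
    rw [h, disjoint_self] at h1
    have h2 : slabCentre c M l' ∈ cube (slabCentre c M l') (1 / (2 * M)) := fun i _ => by
      constructor <;> linarith
    rw [h1] at h2
    exact h2
  have hJ : IsCubeFamily (unitCube (d + 1)) ε (Finset.univ.image (slabCentre (d := d) c M)) := by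
    refine ⟨?_, ?_, ?_⟩
    · intro a ha
      obtain ⟨l, -, rfl⟩ := Finset.mem_image.1 ha
      exact (cube_slabCentre_subset hc l).trans closedBall_subset_unitCube
    · intro a ha b hb hab
      obtain ⟨l, -, rfl⟩ := Finset.mem_image.1 (Finset.mem_coe.1 ha)
      obtain ⟨l', -, rfl⟩ := Finset.mem_image.1 (Finset.mem_coe.1 hb)
      exact disjoint_cube_slabCentre c fun h => hab (by rw [h])
    · rw [Finset.card_image_of_injective _ hinj, Finset.card_univ, Fintype.card_fun,
        Fintype.card_fin, Fintype.card_fin, Nat.cast_pow, Nat.add_sub_cancel,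
        le_div_iff₀ (by positivity), ← mul_pow]
      exact pow_le_one₀ (by positivity) (by linarith)
  have hosc : ∀ l : Fin d → Fin M, ENNReal.ofReal ((1 / 4) ^ (d + 1)) * ‖u - v‖ₑ ≤
      meanOsc f (cube (slabCentre c M l) ε) := by
    intro l
    set a := slabCentre c M l with ha
    have ha0 : a 0 = c := by simp [ha, slabCentre]
    have hball : cube a ε ⊆ Metric.closedBall (fun _ : Fin (d + 1) => (1 / 2 : ℝ)) (1 / 4) :=
      cube_slabCentre_subset hc l
    have hs₁ : cube (fun i => a i + 3 / 8 * ε) (ε / 4) ⊆ cube a ε := fun x hx i hi => by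
      have := hx i hi
      constructor <;> linarith [this.1, this.2]
    have hs₂ : cube a (ε / 4) ⊆ cube a ε := fun x hx i hi => by
      have := hx i hi
      constructor <;> linarith [this.1, this.2]
    have hvol : ∀ b : Fin (d + 1) → ℝ, ENNReal.ofReal ((1 / 4) ^ (d + 1)) ≤
        volume (cube b (ε / 4)) / volume (cube a ε) := fun b => by
      rw [volume_cube, volume_cube, ← ENNReal.ofReal_pow (by positivity),
        ← ENNReal.ofReal_pow (by positivity), ← ENNReal.ofReal_div_of_pos (by positivity),
        ← div_pow]
      refine ENNReal.ofReal_le_ofReal (le_of_eq ?_)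
      congr 1
      field_simp
    -- The first coordinate ranges over `(c + ε / 4, c + ε / 2)` on the shifted subcube and over
    -- `(c - ε / 8, c + ε / 8)` on the concentric one.
    refine mul_enorm_sub_le_meanOsc (measurableSet_cube (fun i => a i + 3 / 8 * ε) (ε / 4))
      (measurableSet_cube a (ε / 4)) ?_ hs₁ hs₂ ?_ ?_ (hvol _) (hvol _)
    · rw [disjoint_left]
      intro x hx hx'
      linarith [(hx 0 (mem_univ 0)).1, (hx' 0 (mem_univ 0)).2]
    · intro x hx
      have h0 := hx 0 (mem_univ 0)
      simp only [ha0] at h0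
      have h1 : 0 ≤ x 0 - c := by linarith [h0.1]
      refine hu x (hball (hs₁ hx)) ?_ ?_ <;> rw [abs_of_nonneg h1] <;> linarith [h0.1, h0.2]
    · intro x hx
      have h0 := hx 0 (mem_univ 0)
      simp only [ha0] at h0
      refine hv x (hball (hs₂ hx)) (abs_le.2 ⟨?_, ?_⟩) <;> linarith [h0.1, h0.2]
  refine le_trans ?_ (le_oscSum hJ f)
  rw [Finset.sum_image fun l _ l' _ h => hinj h, Nat.add_sub_cancel]
  calc ENNReal.ofReal ((1 / 2) ^ d * (1 / 4) ^ (d + 1) * ‖u - v‖)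
      = ENNReal.ofReal (ε ^ d) *
          ∑ _l : Fin d → Fin M, ENNReal.ofReal ((1 / 4) ^ (d + 1)) * ‖u - v‖ₑ := by
        rw [Finset.sum_const, Finset.card_univ, Fintype.card_fun, Fintype.card_fin,
          Fintype.card_fin, nsmul_eq_mul, ← ofReal_norm, ← ENNReal.ofReal_mul (by positivity),
          ← ENNReal.ofReal_natCast, ← ENNReal.ofReal_mul (by positivity),
          ← ENNReal.ofReal_mul (by positivity), ← hεM, Nat.cast_pow, mul_pow]
        congr 1
        ring
    _ ≤ _ := by
        gcongr with l
        exact hosc l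

end LowerBound

/-! ### Linear increments are necessary -/

section Necessity

variable {d : ℕ} {g : ℂ → ℂ}

/-- The building block of the counterexample: a test function, of small norm and supported in a
slab, whose values inside the slab alone force a large oscillation of `g ∘ f`.  It rises to a
value `x` by a multiple of `logBump`, which costs little in norm however large `x` is, and then
jumps to the nearby value `y`. -/
lemma exists_block (hg : ¬ HasLinearIncrements g) {c r δ : ℝ} (hr : 0 < r) (hr1 : r ≤ 1)
    (hδ : 0 < δ) (hc : |c - 1 / 2| + r ≤ 1 / 4) (A : ℝ) :
    ∃ G ∈ testFunctions (unitCube (d + 1)), HasOscBound G (ENNReal.ofReal δ) ∧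
      (∀ z : Fin (d + 1) → ℝ, 2 * r ≤ |z 0 - c| → G z = 0) ∧ ∃ ε ∈ Ioo (0 : ℝ) 1,
        ∀ f : (Fin (d + 1) → ℝ) → ℂ, (∀ z, |z 0 - c| < 2 * r → f z = G z) →
          ENNReal.ofReal ((1 / 2) ^ d * (1 / 4) ^ (d + 1) * A) ≤
            oscSum (unitCube (d + 1)) ε (superposition g f) := by
  -- The jump costs `4 * ‖x - y‖`, and the rise to height `x` costs `‖x‖ * K / m`; `M` is then
  -- chosen so large that the `ε`-cubes, `ε = 1 / (2 * M)`, fit into the plateau of `logBump`.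
  obtain ⟨x, y, hxy, hA⟩ := exists_large_jump hg (δ := δ / 8) (by positivity) A
  obtain ⟨K, hK, hlog⟩ := exists_hasOscBound_logBump d
  obtain ⟨m, hm⟩ := exists_nat_gt (2 * (‖x‖ * K) / δ)
  have hm0 : (0 : ℝ) < m := lt_of_le_of_lt (by positivity) hm
  have hm' : m ≠ 0 := by
    rintro rfl
    simp at hm0
  obtain ⟨M, hMr⟩ := exists_nat_gt (1 + (r / 2 ^ m)⁻¹)
  have hρ : 0 < r / 2 ^ m := by positivity
  have hM1 : (1 : ℝ) < M := lt_of_le_of_lt (by linarith [inv_pos.2 hρ]) hMr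
  have hM0 : (0 : ℝ) < M := by linarith
  have hM : M ≠ 0 := by
    rintro rfl
    simp at hM0
  have hρr : r / 2 ^ m ≤ r := div_le_self hr.le (one_le_pow₀ (by norm_num))
  have hε1 : 1 / (2 * M : ℝ) < 1 := by
    rw [div_lt_one (by positivity)]
    linarith
  have hερ : 1 / (2 * M : ℝ) / 2 ≤ r / 2 ^ m := by
    have h1 : (M : ℝ)⁻¹ ≤ r / 2 ^ m := inv_le_of_inv_le₀ hρ (by linarith)
    have h2 : 1 / (2 * M : ℝ) / 2 = (M : ℝ)⁻¹ / 4 := by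
      field_simp
      norm_num
    have h3 : 0 < (M : ℝ)⁻¹ := by positivity
    linarith
  have hε0 : 0 < 1 / (2 * M : ℝ) := by positivity
  generalize hε_def : 1 / (2 * M : ℝ) = ε at *
  have hε8 : 0 < ε / 8 := by positivity
  have h_log : HasOscBound (fun z : Fin (d + 1) → ℝ => x * logBump c r m z)
      (ENNReal.ofReal (δ / 2)) := by
    refine ((hlog c r hr hr1 m).const_mul x).mono ?_
    rw [← ofReal_norm, ← ENNReal.ofReal_mul (norm_nonneg _)]
    refine ENNReal.ofReal_le_ofReal ?_
    rw [← mul_div_assoc, div_le_iff₀ hm0]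
    rw [div_lt_iff₀ hδ] at hm
    linarith
  have h_jump : HasOscBound (fun z : Fin (d + 1) → ℝ => (y - x) * slabBump c (ε / 8) z)
      (ENNReal.ofReal (δ / 2)) := by
    refine ((hasOscBound_slabBump c hε8 (by linarith)).const_mul (y - x)).mono ?_
    rw [← ofReal_norm, ← ENNReal.ofReal_ofNat, ← ENNReal.ofReal_mul (norm_nonneg _)]
    refine ENNReal.ofReal_le_ofReal ?_
    rw [norm_sub_rev]
    linarith
  refine ⟨fun z => x * logBump c r m z + (y - x) * slabBump c (ε / 8) z,
    add_mem_testFunctions (const_mul_mem_testFunctions _ (logBump_mem_testFunctions _ _ _))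
      (const_mul_mem_testFunctions _ (slabBump_mem_testFunctions _ _)), ?_, ?_, ε, ⟨hε0, hε1⟩, ?_⟩
  · have h := h_log.add h_jump ENNReal.ofReal_ne_top ENNReal.ofReal_ne_top
    rwa [← ENNReal.ofReal_add (by positivity) (by positivity), add_halves] at h
  · intro z hz
    simp only []
    rw [logBump_eq_zero hr m hz, slabBump_eq_zero hε8 (by linarith)]
    simp
  · intro f hf
    beta_reduce at hf
    have hlow : ENNReal.ofReal ((1 / 2) ^ d * (1 / 4) ^ (d + 1) * ‖g x - g y‖) ≤
        oscSum (unitCube (d + 1)) ε (superposition g f) := by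
      rw [← hε_def]
      refine le_oscSum_of_jump hM (c := c) ?_ ?_ ?_ <;> rw [hε_def]
      · linarith
      · intro z hz h1 h2
        have h3 : |z 0 - c| < 2 * r := by linarith
        rw [superposition, hf z h3, logBump_eq_one hr hm' hz (by linarith),
          slabBump_eq_zero hε8 (by linarith)]
        simp
      · intro z hz h1
        have h3 : |z 0 - c| < 2 * r := by linarith
        rw [superposition, hf z h3, logBump_eq_one hr hm' hz (by linarith),
          slabBump_eq_one hε8 hz h1]
        simp
    refine le_trans (ENNReal.ofReal_le_ofReal ?_) hlow
    gcongr

/-- Disjoint slabs accumulating at the hyperplane `x₀ = 1/2`. -/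
lemma eq_of_mem_slabs {t : ℝ} {j k : ℕ}
    (hj : |t - (1 / 2 + (1 / 2) ^ j / 8)| < 2 * ((1 / 2) ^ j / 128))
    (hk : |t - (1 / 2 + (1 / 2) ^ k / 8)| < 2 * ((1 / 2) ^ k / 128)) : j = k := by
  have key : ∀ {j k : ℕ}, |t - (1 / 2 + (1 / 2) ^ j / 8)| < 2 * ((1 / 2) ^ j / 128) →
      |t - (1 / 2 + (1 / 2) ^ k / 8)| < 2 * ((1 / 2) ^ k / 128) → ¬ j < k := by
    intro j k hj hk hjk
    have h1 : ((1 : ℝ) / 2) ^ k ≤ (1 / 2) ^ (j + 1) :=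
      pow_le_pow_of_le_one (by norm_num) (by norm_num) hjk
    rw [pow_succ] at h1
    have h2 : (0 : ℝ) < (1 / 2) ^ j := by positivity
    rw [abs_lt] at hj hk
    linarith [hj.1, hj.2, hk.1, hk.2]
  rcases lt_trichotomy j k with h | h | h
  · exact absurd h (key hj hk)
  · exact h
  · exact absurd h (key hk hj)

lemma tsum_mem_Bc {G : ℕ → (Fin (d + 1) → ℝ) → ℂ} {η : ℕ → ℝ≥0∞}
    (hG : ∀ k, G k ∈ testFunctions (unitCube (d + 1))) (hη : ∀ k, HasOscBound (G k) (η k))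
    (hsum : ∑' k, η k ≠ ⊤) (hp : ∀ x, Summable fun k => G k x) :
    (fun x => ∑' k, G k x) ∈ Bc (d + 1) ∧ (fun x => ∑' k, G k x) ∈ BcUnit (d + 1) := by
  have h := HasOscBound.tsum hη hsum hp
  have hint := h.integrable hsum
  have hnorm : normB (fun x => ∑' k, G k x) < ⊤ :=
    lt_of_le_of_lt h.normB_le (by finiteness)
  have happrox : ∀ δ : ℝ≥0∞, 0 < δ → ∃ φ ∈ testFunctions (unitCube (d + 1)),
      normB ((fun x => ∑' k, G k x) - φ) < δ := by
    intro δ hδ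
    have ht := ENNReal.Tendsto.const_mul (a := 2) (ENNReal.tendsto_sum_nat_add η hsum)
      (Or.inr (by simp))
    rw [mul_zero] at ht
    obtain ⟨N, hN⟩ := (ht.eventually (gt_mem_nhds hδ)).exists
    refine ⟨_, sum_mem_testFunctions (Finset.range N) fun k _ => hG k, ?_⟩
    have e : ((fun x => ∑' k, G k x) - fun x => ∑ k ∈ Finset.range N, G k x) =
        fun x => ∑' k, G (k + N) x := by
      funext x
      rw [Pi.sub_apply, ← (hp x).sum_add_tsum_nat_add N, add_sub_cancel_left]
    rw [e]
    refine lt_of_le_of_lt (HasOscBound.normB_le (HasOscBound.tsum (fun k => hη (k + N)) ?_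
      fun x => (summable_nat_add_iff N).2 (hp x))) hN
    exact ne_top_of_le_ne_top hsum
      (ENNReal.tsum_comp_le_tsum_of_injective (add_left_injective N) η)
  refine ⟨⟨⟨hint.locallyIntegrable, hnorm⟩, fun δ hδ => ?_⟩,
    ⟨⟨hint.integrableOn, (normBUnit_le_normB _).trans_lt hnorm⟩, fun δ hδ => ?_⟩⟩
  · obtain ⟨φ, hφ, h⟩ := happrox δ hδ
    exact ⟨φ, ⟨hφ.1, hφ.2.1, subset_univ _⟩, h⟩
  · obtain ⟨φ, hφ, h⟩ := happrox δ hδ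
    exact ⟨φ, hφ, (normBUnit_le_normB _).trans_lt h⟩

/-- If `g` does not have linear increments, one function witnesses the failure of both
`T_g (B_c) ⊆ B` statements: the sum of blocks in disjoint slabs, with summable norms and
unbounded oscillations of the image under `T_g`. -/
lemma exists_normBUnit_superposition_eq_top (d : ℕ) (hg : ¬ HasLinearIncrements g) :
    ∃ f, f ∈ Bc (d + 1) ∧ f ∈ BcUnit (d + 1) ∧ normBUnit (superposition g f) = ⊤ := by
  have hblock := fun k : ℕ => exists_block (d := d) hg (c := 1 / 2 + (1 / 2) ^ k / 8)
    (r := (1 / 2) ^ k / 128) (δ := (1 / 2) ^ k) (by positivity)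
    (by
      have h : ((1 : ℝ) / 2) ^ k ≤ 1 := pow_le_one₀ (by norm_num) (by norm_num)
      linarith)
    (by positivity)
    (by
      have h : ((1 : ℝ) / 2) ^ k ≤ 1 := pow_le_one₀ (by norm_num) (by norm_num)
      rw [add_sub_cancel_left, abs_of_pos (by positivity)]
      linarith) k
  choose G hG hη h0 ε hε hlow using hblock
  have hsingle : ∀ (x : Fin (d + 1) → ℝ) (k : ℕ),
      |x 0 - (1 / 2 + (1 / 2) ^ k / 8)| < 2 * ((1 / 2) ^ k / 128) → ∀ j, j ≠ k → G j x = 0 := by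
    intro x k hk j hjk
    refine h0 j x (not_lt.1 fun hj => hjk (eq_of_mem_slabs hj hk))
  have hp : ∀ x, Summable fun k => G k x := by
    intro x
    by_cases hx : ∃ k : ℕ, |x 0 - (1 / 2 + (1 / 2) ^ k / 8)| < 2 * ((1 / 2) ^ k / 128)
    · obtain ⟨k, hk⟩ := hx
      exact (hasSum_single k (hsingle x k hk)).summable
    · push Not at hx
      simp only [h0 _ x (hx _)]
      exact summable_zero
  have hsum : ∑' k : ℕ, ENNReal.ofReal ((1 / 2) ^ k) ≠ ⊤ :=
    Summable.tsum_ofReal_ne_top summable_geometric_two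
  obtain ⟨hBc, hBcU⟩ := tsum_mem_Bc hG hη hsum hp
  refine ⟨_, hBc, hBcU, ?_⟩
  set f := fun x => ∑' k, G k x
  have hle : ∀ k : ℕ, ENNReal.ofReal ((1 / 2) ^ d * (1 / 4) ^ (d + 1) * k) ≤
      normBUnit (superposition g f) := by
    intro k
    refine (hlow k f fun z hz => tsum_eq_single k (hsingle z k hz)).trans ?_
    exact (le_iSup₂ (f := fun ε (_ : ε ∈ Ioo (0 : ℝ) 1) =>
      oscSum (unitCube (d + 1)) ε (superposition g f)) (ε k) (hε k)).trans le_add_self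
  by_contra htop
  obtain ⟨k, hk⟩ := exists_nat_gt
    ((normBUnit (superposition g f)).toReal / ((1 / 2) ^ d * (1 / 4) ^ (d + 1)))
  rw [div_lt_iff₀ (by positivity), mul_comm] at hk
  exact absurd hk (not_lt.2 ((ENNReal.ofReal_le_iff_le_toReal htop).1 (hle k)))

end Necessity

end BSpaces

theorem theorem1p1 (n : ℕ) (hn : 1 ≤ n) (g : ℂ → ℂ) (hg : Measurable g) :
    List.TFAE [
      BSpaces.HasLinearIncrements g,
      Set.MapsTo (BSpaces.superposition g) (BSpaces.B n) (BSpaces.B n),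
      Set.MapsTo (BSpaces.superposition g) (BSpaces.Bc n) (BSpaces.B n),
      Set.MapsTo (BSpaces.superposition g) (BSpaces.BUnit n) (BSpaces.BUnit n),
      Set.MapsTo (BSpaces.superposition g) (BSpaces.BcUnit n) (BSpaces.BUnit n)] ∧
    ((BSpaces.HasLinearIncrements g ∨
      Set.MapsTo (BSpaces.superposition g) (BSpaces.B n) (BSpaces.B n) ∨
      Set.MapsTo (BSpaces.superposition g) (BSpaces.Bc n) (BSpaces.B n) ∨
      Set.MapsTo (BSpaces.superposition g) (BSpaces.BUnit n) (BSpaces.BUnit n) ∨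
      Set.MapsTo (BSpaces.superposition g) (BSpaces.BcUnit n) (BSpaces.BUnit n)) →
      (∀ S : Set ((Fin n → ℝ) → ℂ), BSpaces.IsBoundedInB S →
        BSpaces.IsBoundedInB (BSpaces.superposition g '' S)) ∧
      (∀ S : Set ((Fin n → ℝ) → ℂ), BSpaces.IsBoundedInBUnit S →
        BSpaces.IsBoundedInBUnit (BSpaces.superposition g '' S))) := by
  obtain ⟨d, rfl⟩ : ∃ d, n = d + 1 := ⟨n - 1, by omega⟩
  have h12 := fun h : BSpaces.HasLinearIncrements g => h.mapsTo_B (n := d + 1) hg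
  have h14 := fun h : BSpaces.HasLinearIncrements g => h.mapsTo_BUnit (n := d + 1) hg
  have h23 : MapsTo (BSpaces.superposition g) (BSpaces.B (d + 1)) (BSpaces.B (d + 1)) →
      MapsTo (BSpaces.superposition g) (BSpaces.Bc (d + 1)) (BSpaces.B (d + 1)) :=
    fun h _ hf => h hf.1
  have h45 : MapsTo (BSpaces.superposition g) (BSpaces.BUnit (d + 1)) (BSpaces.BUnit (d + 1)) →
      MapsTo (BSpaces.superposition g) (BSpaces.BcUnit (d + 1)) (BSpaces.BUnit (d + 1)) :=
    fun h _ hf => h hf.1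
  have h31 : MapsTo (BSpaces.superposition g) (BSpaces.Bc (d + 1)) (BSpaces.B (d + 1)) →
      BSpaces.HasLinearIncrements g := by
    intro h
    by_contra hl
    obtain ⟨f, hf, -, htop⟩ := BSpaces.exists_normBUnit_superposition_eq_top d hl
    exact absurd (((BSpaces.normBUnit_le_normB _).trans_lt (h hf).2)) (by simp [htop])
  have h51 : MapsTo (BSpaces.superposition g) (BSpaces.BcUnit (d + 1)) (BSpaces.BUnit (d + 1)) →
      BSpaces.HasLinearIncrements g := by
    intro h
    by_contra hl
    obtain ⟨f, -, hf, htop⟩ := BSpaces.exists_normBUnit_superposition_eq_top d hl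
    exact absurd (h hf).2 (by simp [htop])
  refine ⟨?_, fun h => ?_⟩
  · tfae_have 1 → 2 := h12
    tfae_have 2 → 3 := h23
    tfae_have 3 → 1 := h31
    tfae_have 1 → 4 := h14
    tfae_have 4 → 5 := h45
    tfae_have 5 → 1 := h51
    tfae_finish
  · have hl : BSpaces.HasLinearIncrements g := by
      rcases h with h | h | h | h | h
      exacts [h, h31 (h23 h), h31 h, h51 (h45 h), h51 h]
    exact ⟨fun S hS => hl.isBoundedInB_image hg hS, fun S hS => hl.isBoundedInBUnit_image hg hS⟩
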